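/- For a finite index set $I$, the oriented projective space of $\mathbb R^{I}$ is the set of nonzero vectors of $\mathbb R^I$ modulo multiplication by positive reals. A set $S$ of its points is convex if, whenever nonzero $u,v$ represent points of $S$ and $a,b\ge 0$ satisfy $au+bv\neq 0$, the point represented by $au+bv$ lies in $S$; the convex hull $\mathrm{conv}\,S$ is the smallest convex set containing $S$. Let $m,d\ge 0$ be integers. Let $\mathbb P^m_+$ be the set of points of the oriented projective space of $\mathbb R^{m+1}$ represented by $x=[x_0,\dots,x_m]\neq 0$ with $x_0\ge 0$. For $k\ge 0$ let $$\zeta_k(x)=\Big[x_0^{\,k-|\alpha|}\,x_1^{\alpha_1}\cdots x_m^{\alpha_m}\Big]_{\alpha\in\mathbb N^m,\ |\alpha|\le k},\qquad |\alpha|=\alpha_1+\dots+\alpha_m,$$ be the vector of all monomials of degree $k$ in $x_0,\dots,x_m$; it has $s(m,k)+1=\binom{m+k}{k}$ entries. It is nonzero for $x\ne0$, and $x\mapsto\zeta_k(x)$ is well defined between oriented projective spaces. Let $\mathbb P^{s(m,2d)}_+$ be the set of points of the oriented projective space of real sequences $y=[y_\alpha]_{\alpha\in\mathbb N^m,\,|\alpha|\le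 2d}\neq 0$ that satisfy $y_0\ge 0$, where $y_0$ is the entry with index $\alpha=0$. Let $M_d(y)$ be the moment matrix of $y$, with entries $[M_d(y)]_{\alpha,\beta}=y_{\alpha+\beta}$ for $\alpha,\beta\in\mathbb N^m$, $|\alpha|\le d$, $|\beta|\le d$. Put $$\mathcal Z_{m,d}=\mathrm{conv}\,\{\zeta_{2d}(x)\in\mathbb P^{s(m,2d)}_+ : x\in\mathbb P^m_+\},\qquad \mathcal Y_{m,d}=\{y\in\mathbb P^{s(m,2d)}_+ : M_d(y)\succeq 0\}.$$ **Theorem.** If $m=1$, or $d=1$, or $d=m=2$, then $\mathcal Z_{m,d}=\mathcal Y_{m,d}$. -/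

import Mathlib

noncomputable section

namespace MomentHull

/-- The multi-indices `α ∈ ℕ^m` with `|α| = ∑ i, α i ≤ k`. They index the monomials
`x₀ ^ (k - |α|) * x₁ ^ α₁ * ⋯ * x_m ^ α_m` of degree `k` in `x₀, …, x_m`. -/
abbrev MultiIndex (m k : ℕ) : Type :=
  {α : Fin m → ℕ // ∑ i, α i ≤ k}

/-- The zero multi-index, i.e. the index of the first monomial `x₀ ^ k`. -/
def MultiIndex.zero (m k : ℕ) : MultiIndex m k :=
  ⟨fun _ => 0, by simp⟩

/-- The sum of two multi-indices of size at most `d`, of size at most `2 * d`. -/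
def MultiIndex.add {m d : ℕ} (α β : MultiIndex m d) : MultiIndex m (2 * d) :=
  ⟨fun i => α.1 i + β.1 i, by
    rw [Finset.sum_add_distrib]
    have hα := α.2
    have hβ := β.2
    omega⟩

/-- The vector `ζ_k(x)` of all monomials of degree `k` in `x = [x₀, …, x_m]`. -/
def zeta (m k : ℕ) (x : Fin (m + 1) → ℝ) : MultiIndex m k → ℝ :=
  fun α => x 0 ^ (k - ∑ i, α.1 i) * ∏ i, x i.succ ^ α.1 i

/-- The moment matrix `M_d(y)`, with entries `y_{α + β}`, `|α|, |β| ≤ d`. -/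
def momentMatrix (m d : ℕ) (y : MultiIndex m (2 * d) → ℝ) :
    Matrix (MultiIndex m d) (MultiIndex m d) ℝ :=
  Matrix.of fun α β => y (α.add β)

theorem zeta_ne_zero (m k : ℕ) {x : Fin (m + 1) → ℝ} (hx : x ≠ 0) : zeta m k x ≠ 0 := by
  obtain ⟨j, hj⟩ := Function.ne_iff.mp hx
  intro h
  induction j using Fin.cases with
  | zero =>
    have h0 := congrFun h (MultiIndex.zero m k)
    simp only [zeta, MultiIndex.zero, Pi.zero_apply] at h0
    simp at h0
    exact hj h0.1
  | succ j =>
    have h0 := congrFun h ⟨Pi.single j k, by simp⟩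
    simp only [zeta, Pi.zero_apply] at h0
    rw [Finset.prod_eq_single j] at h0
    · simp at h0
      exact hj h0.1
    · intro i _ hij
      simp [Pi.single_eq_of_ne hij]
    · simp

theorem zeta_smul (m k : ℕ) (r : ℝ) (x : Fin (m + 1) → ℝ) :
    zeta m k (r • x) = r ^ k • zeta m k x := by
  funext α
  simp only [zeta, Pi.smul_apply, smul_eq_mul, mul_pow, Finset.prod_mul_distrib,
    Finset.prod_pow_eq_pow_sum]
  have h : r ^ k = r ^ (k - ∑ i, α.1 i) * r ^ (∑ i, α.1 i) := by
    rw [← pow_add, Nat.sub_add_cancel α.2]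
  rw [h]
  ring

/-- The oriented projective space of the real coordinate space `ℝ^ι`: nonzero vectors up to
multiplication by positive reals. -/
abbrev OrientedProj (ι : Type) : Type :=
  Module.Ray ℝ (ι → ℝ)

/-- The points of the oriented projective space having a representative in `C`. -/
def pointsOf {ι : Type} (C : Set (ι → ℝ)) : Set (OrientedProj ι) :=
  {p | ∃ (v : ι → ℝ) (hv : v ≠ 0), v ∈ C ∧ p = rayOfNeZero ℝ v hv}

/-- The points of the oriented projective space whose coordinate with index `i₀` (the first
one) is nonnegative. -/
def nonnegPart {ι : Type} (i₀ : ι) : Set (OrientedProj ι) :=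
  pointsOf {v | 0 ≤ v i₀}

/-- A set of points of the oriented projective space is convex if, with the points represented
by `u` and `v`, it contains the whole segment joining them: all points represented by a nonzero
combination `a • u + b • v` with `a, b ≥ 0`. -/
def IsConvex {ι : Type} (S : Set (OrientedProj ι)) : Prop :=
  ∀ (u v : ι → ℝ) (hu : u ≠ 0) (hv : v ≠ 0),
    rayOfNeZero ℝ u hu ∈ S → rayOfNeZero ℝ v hv ∈ S →
    ∀ a b : ℝ, 0 ≤ a → 0 ≤ b → ∀ h : a • u + b • v ≠ 0, rayOfNeZero ℝ (a • u + b • v) h ∈ S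

/-- The convex hull: the smallest convex set containing `S`. -/
def conv {ι : Type} (S : Set (OrientedProj ι)) : Set (OrientedProj ι) :=
  ⋂₀ {T | IsConvex T ∧ S ⊆ T}

/-- The map induced by `x ↦ ζ_k(x)` between oriented projective spaces. -/
def zetaProj (m k : ℕ) : OrientedProj (Fin (m + 1)) → OrientedProj (MultiIndex m k) :=
  Quotient.lift
    (fun x : RayVector ℝ (Fin (m + 1) → ℝ) =>
      rayOfNeZero ℝ (zeta m k (RayVector.equiv ℝ _ x).1)
        (zeta_ne_zero m k (RayVector.equiv ℝ _ x).2))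
    (by
      intro x y hxy
      obtain ⟨r, hr, h⟩ := SameRay.exists_pos_left hxy
        (RayVector.equiv ℝ _ x).2 (RayVector.equiv ℝ _ y).2
      rw [ray_eq_iff, ← h, zeta_smul]
      exact SameRay.sameRay_pos_smul_right _ (pow_pos hr k))

theorem zetaProj_rayOfNeZero (m k : ℕ) (x : Fin (m + 1) → ℝ) (hx : x ≠ 0) :
    zetaProj m k (rayOfNeZero ℝ x hx) =
      rayOfNeZero ℝ (zeta m k x) (zeta_ne_zero m k hx) :=
  rfl

/-- `Z_{m,d}`: the convex hull of the points `ζ_{2d}(x)`, `x` in the oriented projective space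
with `x₀ ≥ 0`. -/
def Z (m d : ℕ) : Set (OrientedProj (MultiIndex m (2 * d))) :=
  conv {z | z ∈ nonnegPart (MultiIndex.zero m (2 * d)) ∧
    ∃ x ∈ nonnegPart (0 : Fin (m + 1)), z = zetaProj m (2 * d) x}

/-- `Y_{m,d}`: the points `y` with `y₀ ≥ 0` whose moment matrix is positive semidefinite. -/
def Y (m d : ℕ) : Set (OrientedProj (MultiIndex m (2 * d))) :=
  {p | p ∈ nonnegPart (MultiIndex.zero m (2 * d)) ∧
    p ∈ pointsOf {y | (momentMatrix m d y).PosSemidef}}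

end MomentHull

end

/-!
The inclusion `Z ⊆ Y` holds because the moment matrix of `ζ(x)` has rank one and positive
semidefiniteness is a convex condition. The converse is dual to Hilbert's theorem that in the three
cases every nonnegative form is a sum of squares, and it is proved from a weaker property, due to
Choi and Lam: every nonzero nonnegative form of degree `2 d` dominates the square of a nonzero form
of degree `d` (`DominatesSquare`).

*From domination to moments.* Let `y` have a positive semidefinite moment matrix. If `y`, normalized
by the trace of its moment matrix, were outside the compact convex hull of the normalized moment
vectors of the unit sphere, a nonnegative form `c` with `c ⬝ᵥ y < 0` would separate it
(`smul_mem_convexHull_of_posSemidef`). Among the nonnegative forms `g ≤ c` with `g ⬝ᵥ y ≤ c ⬝ᵥ y`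
choose one that minimizes a separating sum of point evaluations. It is not zero, so it dominates
a nonzero square `q ^ 2`. Since `y` is nonnegative on squares, `g - q ^ 2` is again in the set,
which contradicts minimality (`dotProduct_nonneg_of_posSemidef`). Neither closedness of the cone of
sums of squares nor extreme rays are needed.

*Domination.* A positive definite form dominates a multiple of any form of the same degree, by
compactness. A binary form with a zero is divisible by the square of a linear form, which allows
induction (`dominatesSquare_binary`). For quadratic forms the property is the Cauchy-Schwarz
inequality (`dominatesSquare_quadratic`). A ternary quartic with a zero at `(1, 0, 0)` reads
`s² a(w) + 2 s b(w) + c(w)` with binary forms `a`, `b`, `c` and `a c ≥ b²`. If `a` has a zero, then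
a linear form divides `a` twice and `b` once, and completing the square suffices. If `a` and
`a c - b²` are positive definite, the form dominates a multiple of `a²`. Otherwise there is a second
zero, and shears `s ↦ s + L(w)` make `b` divisible by a linear form `l` and `c` by `l²`; the same
alternative for `(a c - b²) / l²` settles this case (`dominatesSquare_ternary_quartic`).
-/

noncomputable section

namespace MomentHull

open Filter Topology

/-! ### Forms as homogeneous polynomial functions -/

/-- `IsForm k f` says that `f : ℝ^ι → ℝ` is (the function of) a form, i.e. a homogeneous polynomial,
of degree `k`: a constant if `k = 0`, and otherwise a sum `∑ i, x i * g i x` with forms `g i` of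
degree `k - 1`. -/
def IsForm {ι : Type} [Fintype ι] : ℕ → ((ι → ℝ) → ℝ) → Prop
  | 0, f => ∃ c : ℝ, ∀ x, f x = c
  | k + 1, f => ∃ g : ι → (ι → ℝ) → ℝ, (∀ i, IsForm k (g i)) ∧ ∀ x, f x = ∑ i, x i * g i x

theorem exists_eq_smul_mem_sphere {ι : Type} [Fintype ι] [Nonempty ι] (x : ι → ℝ) :
    ∃ t : ℝ, 0 ≤ t ∧ ∃ v ∈ Metric.sphere (0 : ι → ℝ) 1, x = t • v := by
  by_cases hx : x = 0
  · exact ⟨0, le_rfl, fun _ => 1, by simp, by simp [hx]⟩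
  · refine ⟨‖x‖, norm_nonneg x, ‖x‖⁻¹ • x, by simp [norm_smul, hx], ?_⟩
    rw [smul_smul, mul_inv_cancel₀ (norm_ne_zero_iff.mpr hx), one_smul]

namespace IsForm

variable {ι κ : Type} [Fintype ι] [Fintype κ] {k l : ℕ} {f g : (ι → ℝ) → ℝ}

theorem const (c : ℝ) : IsForm (ι := ι) 0 (fun _ => c) := ⟨c, fun _ => rfl⟩

theorem zero : ∀ k : ℕ, IsForm (ι := ι) k (fun _ => 0)
  | 0 => const 0
  | k + 1 => ⟨fun _ _ => 0, fun _ => zero k, fun _ => by simp⟩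

theorem add {k : ℕ} {f g : (ι → ℝ) → ℝ} (hf : IsForm k f) (hg : IsForm k g) :
    IsForm k (fun x => f x + g x) := by
  induction k generalizing f g with
  | zero =>
    obtain ⟨a, ha⟩ := hf
    obtain ⟨b, hb⟩ := hg
    exact ⟨a + b, fun x => by simp only [ha, hb]⟩
  | succ k ih =>
    obtain ⟨a, ha, ha'⟩ := hf
    obtain ⟨b, hb, hb'⟩ := hg
    exact ⟨fun i x => a i x + b i x, fun i => ih (ha i) (hb i), fun x => by
      simp only [ha', hb', ← Finset.sum_add_distrib]
      exact Finset.sum_congr rfl fun i _ => by ring⟩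

theorem smul {k : ℕ} {f : (ι → ℝ) → ℝ} (c : ℝ) (hf : IsForm k f) :
    IsForm k (fun x => c * f x) := by
  induction k generalizing f with
  | zero =>
    obtain ⟨a, ha⟩ := hf
    exact ⟨c * a, fun x => by simp only [ha]⟩
  | succ k ih =>
    obtain ⟨a, ha, ha'⟩ := hf
    exact ⟨fun i x => c * a i x, fun i => ih (ha i), fun x => by
      simp only [ha', Finset.mul_sum]
      exact Finset.sum_congr rfl fun i _ => by ring⟩

theorem neg (hf : IsForm k f) : IsForm k (fun x => -f x) := by
  simpa using hf.smul (-1)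

theorem sub (hf : IsForm k f) (hg : IsForm k g) : IsForm k (fun x => f x - g x) := by
  simpa [sub_eq_add_neg] using hf.add hg.neg

theorem sum {σ : Type*} (s : Finset σ) {F : σ → (ι → ℝ) → ℝ} (h : ∀ j ∈ s, IsForm k (F j)) :
    IsForm k (fun x => ∑ j ∈ s, F j x) := by
  classical
  induction s using Finset.induction_on with
  | empty => simpa using zero k
  | insert a s ha ih =>
    simp only [Finset.sum_insert ha]
    exact (h a (by simp)).add (ih fun j hj => h j (Finset.mem_insert_of_mem hj))

theorem mul {k : ℕ} {f : (ι → ℝ) → ℝ} (hf : IsForm k f) (hg : IsForm l g) :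
    IsForm (k + l) (fun x => f x * g x) := by
  induction k generalizing f with
  | zero =>
    obtain ⟨c, hc⟩ := hf
    simpa [hc] using hg.smul c
  | succ k ih =>
    obtain ⟨a, ha, ha'⟩ := hf
    rw [Nat.add_right_comm]
    exact ⟨fun i x => a i x * g x, fun i => ih (ha i), fun x => by
      simp only [ha', Finset.sum_mul]
      exact Finset.sum_congr rfl fun i _ => by ring⟩

theorem coord (i : ι) : IsForm 1 (fun x : ι → ℝ => x i) := by
  classical
  exact ⟨fun j _ => if j = i then 1 else 0, fun j => const _, fun x => by simp⟩

theorem pow (hf : IsForm k f) (n : ℕ) : IsForm (n * k) (fun x => f x ^ n) := by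
  induction n with
  | zero => simpa using const 1
  | succ n ih => simpa only [pow_succ, add_mul, one_mul] using ih.mul hf

theorem prod {σ : Type*} (s : Finset σ) {F : σ → (ι → ℝ) → ℝ} {e : σ → ℕ}
    (h : ∀ j ∈ s, IsForm (e j) (F j)) :
    IsForm (∑ j ∈ s, e j) (fun x => ∏ j ∈ s, F j x) := by
  classical
  induction s using Finset.induction_on with
  | empty => simpa using const 1
  | insert a s ha ih =>
    simp only [Finset.sum_insert ha, Finset.prod_insert ha]
    exact (h a (by simp)).mul (ih fun j hj => h j (Finset.mem_insert_of_mem hj))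

theorem coord_mul (i : ι) (hf : IsForm k f) : IsForm (k + 1) (fun x => x i * f x) := by
  simpa only [Nat.add_comm] using (coord i).mul hf

theorem linear (A : (ι → ℝ) →ₗ[ℝ] ℝ) : IsForm 1 (fun x => A x) := by
  classical
  refine ⟨fun i _ => A (Pi.single i 1), fun i => const _, fun x => ?_⟩
  conv_lhs => rw [pi_eq_sum_univ' x]
  simp [map_sum]

theorem exists_linearMap (hf : IsForm 1 f) : ∃ A : (ι → ℝ) →ₗ[ℝ] ℝ, ∀ x, f x = A x := by
  obtain ⟨a, ha, hf'⟩ := hf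
  choose c hc using ha
  exact ⟨∑ i, c i • LinearMap.proj i, fun x => by simp [hf', hc, mul_comm]⟩

theorem comp {k : ℕ} {f : (ι → ℝ) → ℝ} (hf : IsForm k f) (A : (κ → ℝ) →ₗ[ℝ] (ι → ℝ)) :
    IsForm k (fun x => f (A x)) := by
  induction k generalizing f with
  | zero =>
    obtain ⟨c, hc⟩ := hf
    exact ⟨c, fun x => hc _⟩
  | succ k ih =>
    obtain ⟨a, ha, ha'⟩ := hf
    simp only [ha']
    refine sum _ fun i _ => ?_
    rw [Nat.add_comm]
    exact (linear (LinearMap.proj i ∘ₗ A)).mul (ih (ha i))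

/-- The variables of a form in `n` variables may be regarded as the last `n` of `n + 1`. -/
theorem comp_tail {n : ℕ} {f : (Fin n → ℝ) → ℝ} (hf : IsForm k f) :
    IsForm k (fun x : Fin (n + 1) → ℝ => f (Fin.tail x)) :=
  hf.comp (LinearMap.funLeft ℝ ℝ Fin.succ)

theorem continuous {k : ℕ} {f : (ι → ℝ) → ℝ} (hf : IsForm k f) : Continuous f := by
  induction k generalizing f with
  | zero =>
    obtain ⟨c, hc⟩ := hf
    rw [funext hc]
    exact continuous_const
  | succ k ih =>
    obtain ⟨a, ha, ha'⟩ := hf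
    rw [funext ha']
    exact continuous_finsetSum _ fun i _ => (continuous_apply i).mul (ih (ha i))

theorem homogeneous {k : ℕ} {f : (ι → ℝ) → ℝ} (hf : IsForm k f) (t : ℝ) (x : ι → ℝ) :
    f (t • x) = t ^ k * f x := by
  induction k generalizing f with
  | zero =>
    obtain ⟨c, hc⟩ := hf
    simp [hc]
  | succ k ih =>
    obtain ⟨a, ha, ha'⟩ := hf
    simp only [ha', ih (ha _), Finset.mul_sum, Pi.smul_apply, smul_eq_mul]
    exact Finset.sum_congr rfl fun i _ => by ring

/-- Splitting off the first variable. -/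
theorem exists_eq_mul_add {n k : ℕ} {f : (Fin (n + 1) → ℝ) → ℝ} (hf : IsForm (k + 1) f) :
    ∃ (g : (Fin (n + 1) → ℝ) → ℝ) (h : (Fin n → ℝ) → ℝ), IsForm k g ∧ IsForm (k + 1) h ∧
      ∀ x, f x = x 0 * g x + h (Fin.tail x) := by
  induction k generalizing f with
  | zero =>
    obtain ⟨a, ha, ha'⟩ := hf
    choose c hc using ha
    refine ⟨a 0, fun w => ∑ i : Fin n, w i * c i.succ, ⟨c 0, hc 0⟩,
      ⟨fun i _ => c i.succ, fun i => const _, fun _ => rfl⟩, fun x => ?_⟩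
    rw [ha', Fin.sum_univ_succ]
    simp [hc, Fin.tail]
  | succ k ih =>
    obtain ⟨a, ha, ha'⟩ := hf
    choose g h hg hh hgh using fun i : Fin n => ih (ha i.succ)
    refine ⟨fun x => a 0 x + ∑ i : Fin n, x i.succ * g i x, fun w => ∑ i : Fin n, w i * h i w,
      (ha 0).add (sum _ fun i _ => (hg i).coord_mul i.succ), ⟨h, hh, fun _ => rfl⟩, fun x => ?_⟩
    · rw [ha', Fin.sum_univ_succ, mul_add, add_assoc, Finset.mul_sum, ← Finset.sum_add_distrib]
      congr 1
      refine Finset.sum_congr rfl fun i _ => ?_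
      rw [hgh, Fin.tail]
      ring

/-- A form that is positive away from the origin dominates a positive multiple of any form of the
same degree, by compactness of the unit sphere. -/
theorem exists_pos_mul_le [Nonempty ι] (hf : IsForm k f) (hg : IsForm k g)
    (hpos : ∀ x, x ≠ 0 → 0 < f x) : ∃ ε : ℝ, 0 < ε ∧ ∀ x, ε * g x ≤ f x := by
  have hK : IsCompact (Metric.sphere (0 : ι → ℝ) 1) := isCompact_sphere 0 1
  have hne : ∀ x ∈ Metric.sphere (0 : ι → ℝ) 1, f x ≠ 0 := fun x hx =>
    (hpos x (by rintro rfl; simp at hx)).ne'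
  obtain ⟨M, hM⟩ := hK.exists_bound_of_continuousOn (f := fun x => g x / f x)
    (hg.continuous.continuousOn.div hf.continuous.continuousOn hne)
  refine ⟨(|M| + 1)⁻¹, by positivity, fun x => ?_⟩
  have key : ∀ x ∈ Metric.sphere (0 : ι → ℝ) 1, (|M| + 1)⁻¹ * g x ≤ f x := by
    intro x hx
    have h0 : 0 < f x := hpos x (by rintro rfl; simp at hx)
    have h1 : g x / f x ≤ |M| + 1 :=
      (le_abs_self _).trans (((hM x hx).trans (le_abs_self M)).trans (by linarith))
    rw [inv_mul_le_iff₀ (by positivity)]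
    rwa [div_le_iff₀ h0] at h1
  obtain ⟨t, ht, v, hv, rfl⟩ := exists_eq_smul_mem_sphere x
  rw [hf.homogeneous, hg.homogeneous, mul_left_comm]
  exact mul_le_mul_of_nonneg_left (key v hv) (pow_nonneg ht k)

/-- If `f ≥ 0` off the zero set of a nonzero linear form, then `f ≥ 0` everywhere. -/
theorem nonneg_of_nonneg_of_ne_zero (hf : IsForm k f) {L : (ι → ℝ) → ℝ} (hL : IsForm 1 L)
    {u : ι → ℝ} (hu : L u ≠ 0) (h : ∀ x, L x ≠ 0 → 0 ≤ f x) (x : ι → ℝ) : 0 ≤ f x := by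
  by_contra! hx
  have hLx : L x = 0 := by
    by_contra h0
    exact absurd (h x h0) (not_le.mpr hx)
  obtain ⟨A, hA⟩ := hL.exists_linearMap
  have hlin : ∀ t : ℝ, L (x + t • u) = t * L u := fun t => by
    rw [hA] at hLx
    simp [hA, hLx]
  have hcont : Continuous fun t : ℝ => f (x + t • u) := hf.continuous.comp (by fun_prop)
  have hev : ∀ᶠ t in 𝓝[≠] (0 : ℝ), f (x + t • u) < 0 := by
    refine Filter.Eventually.filter_mono nhdsWithin_le_nhds ?_
    exact (hcont.tendsto 0).eventually (gt_mem_nhds (by simpa using hx))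
  obtain ⟨t, ht, ht0⟩ := (hev.and self_mem_nhdsWithin).exists
  exact absurd (h _ (by rw [hlin]; exact mul_ne_zero ht0 hu)) (not_le.mpr ht)

theorem exists_ne_zero_and_ne_zero (hf : IsForm k f) {L : (ι → ℝ) → ℝ} (hL : IsForm 1 L)
    (hL' : ∃ u, L u ≠ 0) (hf' : ∃ u, f u ≠ 0) : ∃ u, L u ≠ 0 ∧ f u ≠ 0 := by
  obtain ⟨u, hu⟩ := hL'
  obtain ⟨v, hv⟩ := hf'
  by_contra! h
  have := (hf.pow 2).neg.nonneg_of_nonneg_of_ne_zero hL hu (fun x hx => by simp [h x hx]) v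
  have := pow_pos (abs_pos.mpr hv) 2
  rw [sq_abs] at this
  linarith

end IsForm

/-- `f` dominates the square of a form of degree `d` that is not identically zero. -/
def DominatesSquare {ι : Type} [Fintype ι] (d : ℕ) (f : (ι → ℝ) → ℝ) : Prop :=
  ∃ q : (ι → ℝ) → ℝ, IsForm d q ∧ (∃ x, q x ≠ 0) ∧ ∀ x, q x ^ 2 ≤ f x

namespace DominatesSquare

variable {ι κ : Type} [Fintype ι] [Fintype κ] {d : ℕ} {f : (ι → ℝ) → ℝ}

theorem of_comp (A : (κ → ℝ) ≃ₗ[ℝ] (ι → ℝ)) (h : DominatesSquare d (fun x => f (A x))) :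
    DominatesSquare d f := by
  obtain ⟨q, hq, ⟨x, hx⟩, hqf⟩ := h
  exact ⟨fun x => q (A.symm x), hq.comp A.symm.toLinearMap, ⟨A x, by simpa using hx⟩,
    fun x => by simpa using hqf (A.symm x)⟩

/-- A positive multiple of a square is a square. -/
theorem of_mul {c : ℝ} (hc : 0 < c) {q : (ι → ℝ) → ℝ} (hq : IsForm d q) {u : ι → ℝ}
    (hu : q u ≠ 0) (h : ∀ x, c * q x ^ 2 ≤ f x) : DominatesSquare d f := by
  refine ⟨fun x => √c * q x, hq.smul _, ⟨u, mul_ne_zero (Real.sqrt_pos.mpr hc).ne' hu⟩,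
    fun x => ?_⟩
  rw [mul_pow, Real.sq_sqrt hc.le]
  exact h x

theorem of_pos [Nonempty ι] (hf : IsForm (2 * d) f) (hpos : ∀ x, x ≠ 0 → 0 < f x) :
    DominatesSquare d f := by
  classical
  obtain ⟨i⟩ := ‹Nonempty ι›
  have hq : IsForm d (fun x : ι → ℝ => x i ^ d) := by simpa using (IsForm.coord i).pow d
  obtain ⟨ε, hε, h⟩ := hf.exists_pos_mul_le (hq.pow 2) hpos
  exact of_mul hε hq (u := Pi.single i 1) (by simp) h

end DominatesSquare

/-! ### Binary forms -/

/-- The function `t * r t` has a minimum at `0`, where its derivative is `r 0`. -/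
theorem eq_zero_of_forall_mul_nonneg {r : ℝ → ℝ} (hr : Continuous r) (h : ∀ t, 0 ≤ t * r t) :
    r 0 = 0 := by
  have hmin : IsLocalMin (fun t => t * r t) 0 := Eventually.of_forall fun t => by simpa using h t
  refine hmin.hasDerivAt_eq_zero (hasDerivAt_iff_tendsto_slope.mpr ?_)
  refine ((hr.tendsto 0).mono_left nhdsWithin_le_nhds).congr' ?_
  filter_upwards [self_mem_nhdsWithin] with t ht
  have ht' : t ≠ 0 := ht
  simp [slope_def_field, ht']

/-- The linear form on `ℝ²` that vanishes on the line spanned by `v`. -/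
def cross (v x : Fin 2 → ℝ) : ℝ := v 0 * x 1 - v 1 * x 0

theorem isForm_cross (v : Fin 2 → ℝ) : IsForm 1 (cross v) :=
  ((IsForm.coord 1).smul (v 0)).sub ((IsForm.coord 0).smul (v 1))

theorem sq_add_sq_pos {v : Fin 2 → ℝ} (hv : v ≠ 0) : 0 < v 0 ^ 2 + v 1 ^ 2 := by
  by_contra! h
  have h0 : v 0 = 0 := by nlinarith [sq_nonneg (v 0), sq_nonneg (v 1)]
  have h1 : v 1 = 0 := by nlinarith [sq_nonneg (v 0), sq_nonneg (v 1)]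
  exact hv (funext fun i => by fin_cases i <;> assumption)

theorem exists_cross_ne_zero {v : Fin 2 → ℝ} (hv : v ≠ 0) : ∃ u, cross v u ≠ 0 :=
  ⟨![-v 1, v 0], by
    have := sq_add_sq_pos hv
    simp only [cross, Matrix.cons_val_zero, Matrix.cons_val_one]
    nlinarith⟩

/-- A binary form vanishing on a line is divisible by the equation of the line. -/
theorem IsForm.exists_eq_cross_mul {k : ℕ} {f : (Fin 2 → ℝ) → ℝ} (hf : IsForm (k + 1) f)
    {v : Fin 2 → ℝ} (hv : v ≠ 0) (hfv : f v = 0) :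
    ∃ g, IsForm k g ∧ ∀ x, f x = cross v x * g x := by
  have hN := sq_add_sq_pos hv
  set N := v 0 ^ 2 + v 1 ^ 2 with hNdef
  -- coordinates in which `v` is the second basis vector
  let A := Matrix.mulVecLin !![v 1, v 0; -v 0, v 1]
  let B := Matrix.mulVecLin !![v 1 / N, -v 0 / N; v 0 / N, v 1 / N]
  have hAB : ∀ x, A (B x) = x := fun x => by
    funext i
    fin_cases i <;> simp [A, B, Matrix.mulVec, dotProduct,
      Fin.sum_univ_two] <;> field_simp <;> rw [hNdef] <;> ring
  obtain ⟨g, h, hg, hh, hgh⟩ := (hf.comp A).exists_eq_mul_add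
  have h1 : h (fun _ => 1) = 0 := by
    have := hgh ![0, 1]
    have hA : A ![0, 1] = v := by
      funext i
      fin_cases i <;> simp [A, Matrix.mulVec, dotProduct]
    rw [hA, hfv] at this
    rw [show (fun _ => 1 : Fin 1 → ℝ) = Fin.tail ![0, 1] from by
      funext i; fin_cases i; simp [Fin.tail]]
    simpa using this.symm
  have h0 : ∀ w, h w = 0 := fun w => by
    rw [show w = w 0 • (fun _ => 1 : Fin 1 → ℝ) from by funext i; fin_cases i; simp,
      hh.homogeneous, h1, mul_zero]
  refine ⟨fun x => -N⁻¹ * g (B x), (hg.comp B).smul _, fun x => ?_⟩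
  rw [← hAB x, hgh, h0, hAB]
  simp [B, Matrix.mulVec, dotProduct, Fin.sum_univ_two, cross]
  ring

/-- A nonnegative binary form vanishes doubly at each of its zeros. -/
theorem IsForm.exists_eq_cross_sq_mul {k : ℕ} {f : (Fin 2 → ℝ) → ℝ} (hf : IsForm (k + 2) f)
    (hnn : ∀ x, 0 ≤ f x) {v : Fin 2 → ℝ} (hv : v ≠ 0) (hfv : f v = 0) :
    ∃ g, IsForm k g ∧ (∀ x, 0 ≤ g x) ∧ ∀ x, f x = cross v x ^ 2 * g x := by
  obtain ⟨g, hg, hfg⟩ := hf.exists_eq_cross_mul hv hfv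
  obtain ⟨u, hu⟩ := exists_cross_ne_zero hv
  have hgv : g v = 0 := by
    have hc : Continuous fun t : ℝ => cross v u * g (v + t • u) :=
      continuous_const.mul (hg.continuous.comp (by fun_prop))
    have := eq_zero_of_forall_mul_nonneg hc fun t => by
      have h1 := hnn (v + t • u)
      rw [hfg] at h1
      convert h1 using 1
      rw [← mul_assoc]
      congr 1
      simp only [cross, Pi.add_apply, Pi.smul_apply, smul_eq_mul]
      ring
    simpa [hu] using this
  obtain ⟨r, hr, hgr⟩ := hg.exists_eq_cross_mul hv hgv
  have hfr : ∀ x, f x = cross v x ^ 2 * r x := fun x => by rw [hfg, hgr]; ring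
  refine ⟨r, hr, hr.nonneg_of_nonneg_of_ne_zero (isForm_cross v) hu fun x hx => ?_, hfr⟩
  have := hnn x
  rw [hfr] at this
  exact nonneg_of_mul_nonneg_right this (by positivity)

/-- Divide by the squares of linear forms until no zeros are left. -/
theorem dominatesSquare_binary {d : ℕ} {f : (Fin 2 → ℝ) → ℝ} (hf : IsForm (2 * d) f)
    (hnn : ∀ x, 0 ≤ f x) (hne : ∃ x, f x ≠ 0) : DominatesSquare d f := by
  induction d generalizing f with
  | zero =>
    obtain ⟨c, hc⟩ := hf
    obtain ⟨x, hx⟩ := hne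
    exact .of_pos ⟨c, hc⟩ fun y _ =>
      lt_of_le_of_ne (hnn y) (by rw [hc]; rw [hc] at hx; exact hx.symm)
  | succ d ih =>
    by_cases h : ∃ v, v ≠ 0 ∧ f v = 0
    · obtain ⟨v, hv, hfv⟩ := h
      obtain ⟨g, hg, hg0, hfg⟩ := IsForm.exists_eq_cross_sq_mul (k := 2 * d) hf hnn hv hfv
      obtain ⟨x, hx⟩ := hne
      obtain ⟨q, hq, hq0, hqg⟩ := ih hg hg0 ⟨x, fun h0 => hx (by rw [hfg, h0, mul_zero])⟩
      obtain ⟨u, hu, hu'⟩ := hq.exists_ne_zero_and_ne_zero (isForm_cross v)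
        (exists_cross_ne_zero hv) hq0
      refine ⟨fun x => cross v x * q x, ?_, ⟨u, mul_ne_zero hu hu'⟩, fun x => ?_⟩
      · rw [Nat.add_comm]
        exact (isForm_cross v).mul hq
      · rw [hfg, mul_pow]
        exact mul_le_mul_of_nonneg_left (hqg x) (sq_nonneg _)
    · push Not at h
      exact .of_pos hf fun x hx => lt_of_le_of_ne (hnn x) (h x hx).symm

/-! ### Ternary quartics and quadratic forms -/

/-- A form that is quadratic in its first variable `s`, with the forms `a`, `b`, `c` in the other
variables `w` as coefficients: `s² a(w) + 2 s b(w) + c(w)`. -/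
def quadIn {n : ℕ} (a b c : (Fin n → ℝ) → ℝ) (x : Fin (n + 1) → ℝ) : ℝ :=
  x 0 ^ 2 * a (Fin.tail x) + 2 * x 0 * b (Fin.tail x) + c (Fin.tail x)

section quadIn

variable {n : ℕ} {a b c : (Fin n → ℝ) → ℝ}

theorem quadIn_cons (s : ℝ) (w : Fin n → ℝ) :
    quadIn a b c (Fin.cons s w) = s ^ 2 * a w + 2 * s * b w + c w := by
  simp [quadIn]

theorem nonneg_of_quadIn_nonneg (h : ∀ x, 0 ≤ quadIn a b c x) (w : Fin n → ℝ) : 0 ≤ c w := by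
  simpa [quadIn_cons] using h (Fin.cons 0 w)

theorem sq_le_mul_of_quadIn_nonneg (h : ∀ x, 0 ≤ quadIn a b c x) (w : Fin n → ℝ) :
    b w ^ 2 ≤ a w * c w := by
  have := discrim_le_zero (a := a w) (b := 2 * b w) (c := c w) fun s => by
    have := h (Fin.cons s w)
    rw [quadIn_cons] at this
    linarith
  rw [discrim] at this
  linarith

theorem leadingCoeff_nonneg_of_quadIn_nonneg (h : ∀ x, 0 ≤ quadIn a b c x) (w : Fin n → ℝ) :
    0 ≤ a w := by
  by_contra! ha
  have hc := nonneg_of_quadIn_nonneg h w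
  have hd := sq_le_mul_of_quadIn_nonneg h w
  have hc0 : c w = 0 := by nlinarith [sq_nonneg (b w)]
  have hb0 : b w = 0 := by
    rw [hc0, mul_zero] at hd
    exact pow_eq_zero_iff two_ne_zero |>.mp (le_antisymm hd (sq_nonneg _))
  have := h (Fin.cons 1 w)
  rw [quadIn_cons, hc0, hb0] at this
  linarith

/-- The substitution `s ↦ s + L w`, for a linear form `L`. -/
theorem quadIn_shear {L : (Fin n → ℝ) → ℝ} (hL : IsForm 1 L) :
    ∃ A : (Fin (n + 1) → ℝ) ≃ₗ[ℝ] (Fin (n + 1) → ℝ), ∀ x, quadIn a b c (A x) =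
      quadIn a (fun w => b w + L w * a w) (fun w => c w + 2 * L w * b w + L w ^ 2 * a w) x := by
  obtain ⟨B, hB⟩ := hL.exists_linearMap
  refine ⟨
    { toFun := fun x => Fin.cons (x 0 + B (Fin.tail x)) (Fin.tail x)
      invFun := fun x => Fin.cons (x 0 - B (Fin.tail x)) (Fin.tail x)
      map_add' := fun x y => ?_
      map_smul' := fun r x => ?_
      left_inv := fun x => ?_
      right_inv := fun x => ?_ }, fun x => ?_⟩
  · funext i
    have h : Fin.tail (x + y) = Fin.tail x + Fin.tail y := rfl
    refine Fin.cases ?_ (fun i => ?_) i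
    · simp only [Fin.cons_zero, Pi.add_apply, h, map_add]
      ring
    · simp [h]
  · funext i
    have h : Fin.tail (r • x) = r • Fin.tail x := rfl
    refine Fin.cases ?_ (fun i => ?_) i
    · simp only [Fin.cons_zero, Pi.smul_apply, h, map_smul, RingHom.id_apply, smul_eq_mul]
      ring
    · simp [h]
  · simp
  · simp
  · change quadIn a b c (Fin.cons (x 0 + B (Fin.tail x)) (Fin.tail x)) = _
    rw [quadIn_cons, quadIn, ← hB]
    ring

theorem DominatesSquare.of_shear {d : ℕ} {L : (Fin n → ℝ) → ℝ} (hL : IsForm 1 L)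
    (h : (∀ x, 0 ≤ quadIn a (fun w => b w + L w * a w)
        (fun w => c w + 2 * L w * b w + L w ^ 2 * a w) x) →
      DominatesSquare d (quadIn a (fun w => b w + L w * a w)
        (fun w => c w + 2 * L w * b w + L w ^ 2 * a w)))
    (hnn : ∀ x, 0 ≤ quadIn a b c x) : DominatesSquare d (quadIn a b c) := by
  obtain ⟨A, hA⟩ := quadIn_shear (a := a) (b := b) (c := c) hL
  refine .of_comp A ?_
  rw [show (fun x => quadIn a b c (A x)) = _ from funext hA]
  exact h fun x => by rw [← hA]; exact hnn _

/-- A nonnegative quartic vanishing at `(1, 0, …, 0)` has degree at most two in the first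
variable. -/
theorem IsForm.exists_eq_quadIn {F : (Fin (n + 1) → ℝ) → ℝ} (hF : IsForm 4 F)
    (hnn : ∀ x, 0 ≤ F x) (h0 : F (Pi.single 0 1) = 0) :
    ∃ a b c : (Fin n → ℝ) → ℝ, IsForm 2 a ∧ IsForm 3 b ∧ IsForm 4 c ∧ F = quadIn a b c := by
  obtain ⟨G3, f4, hG3, hf4, hF3⟩ := hF.exists_eq_mul_add
  obtain ⟨G2, f3, hG2, hf3, hF2⟩ := hG3.exists_eq_mul_add
  obtain ⟨G1, f2, hG1, hf2, hF1⟩ := hG2.exists_eq_mul_add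
  obtain ⟨G0, f1, ⟨e, he⟩, hf1, hF0⟩ := hG1.exists_eq_mul_add
  have hexp : ∀ x, F x = x 0 ^ 4 * e + x 0 ^ 3 * f1 (Fin.tail x) + x 0 ^ 2 * f2 (Fin.tail x) +
      x 0 * f3 (Fin.tail x) + f4 (Fin.tail x) := fun x => by
    rw [hF3, hF2, hF1, hF0, he]
    ring
  have htail : Fin.tail (Pi.single 0 1 : Fin (n + 1) → ℝ) = 0 := by
    funext i
    simp [Fin.tail]
  have hzero : ∀ {k : ℕ} {f : (Fin n → ℝ) → ℝ}, IsForm (k + 1) f → f 0 = 0 := fun hf => by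
    simpa using hf.homogeneous 0 0
  have he0 : e = 0 := by
    have := hexp (Pi.single 0 1)
    rw [h0, htail, hzero hf1, hzero hf2, hzero hf3, hzero hf4] at this
    simpa using this.symm
  have hf10 : ∀ w, f1 w = 0 := fun w => by
    -- `F (1, t w) = t (f1 w + t f2 w + ⋯)` is nonnegative for all `t`
    have := eq_zero_of_forall_mul_nonneg
      (r := fun t => f1 w + t * f2 w + t ^ 2 * f3 w + t ^ 3 * f4 w) (by fun_prop) fun t => by
        have := hnn (Fin.cons 1 (t • w))
        rw [hexp, he0] at this
        simp only [Fin.cons_zero, Fin.tail_cons, hf1.homogeneous, hf2.homogeneous,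
          hf3.homogeneous, hf4.homogeneous] at this
        convert this using 1
        ring
    simpa using this
  refine ⟨f2, fun w => 2⁻¹ * f3 w, f4, hf2, hf3.smul _, hf4, funext fun x => ?_⟩
  rw [hexp, he0, hf10, quadIn]
  ring

end quadIn

section ternary

variable {a b c : (Fin 2 → ℝ) → ℝ}

theorem isForm_mul_zero_add {n k : ℕ} {p q : (Fin n → ℝ) → ℝ} (hp : IsForm k p)
    (hq : IsForm (k + 1) q) :
    IsForm (k + 1) (fun x : Fin (n + 1) → ℝ => x 0 * p (Fin.tail x) + q (Fin.tail x)) :=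
  (hp.comp_tail.coord_mul 0).add hq.comp_tail

/-- The leading coefficient is a semidefinite quadratic form of rank at most one: complete the
square with respect to the first variable times a linear form, or reduce to binary forms. -/
theorem dominatesSquare_of_leadingCoeff_zero (ha : IsForm 2 a) (hb : IsForm 3 b) (hc : IsForm 4 c)
    (hnn : ∀ x, 0 ≤ quadIn a b c x) (hne : ∃ x, quadIn a b c x ≠ 0) {v : Fin 2 → ℝ} (hv : v ≠ 0)
    (hav : a v = 0) : DominatesSquare 2 (quadIn a b c) := by
  have ha0 := leadingCoeff_nonneg_of_quadIn_nonneg hnn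
  have hc0 := nonneg_of_quadIn_nonneg hnn
  have hdisc := sq_le_mul_of_quadIn_nonneg hnn
  obtain ⟨r, ⟨e, he⟩, hr0, har⟩ := IsForm.exists_eq_cross_sq_mul (k := 0) ha ha0 hv hav
  have he0 : 0 ≤ e := by rw [← he 0]; exact hr0 0
  obtain ⟨u, hu⟩ := exists_cross_ne_zero hv
  rcases he0.eq_or_lt with rfl | hepos
  · -- the form does not involve the first variable
    have ha' : ∀ w, a w = 0 := fun w => by rw [har, he, mul_zero]
    have hb' : ∀ w, b w = 0 := fun w => by
      have := hdisc w
      rw [ha', zero_mul] at this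
      exact pow_eq_zero_iff two_ne_zero |>.mp (le_antisymm this (sq_nonneg _))
    have hF : quadIn a b c = fun x => c (Fin.tail x) := funext fun x => by simp [quadIn, ha', hb']
    rw [hF] at hne ⊢
    obtain ⟨x, hx⟩ := hne
    obtain ⟨q, hq, ⟨w, hw⟩, hqc⟩ := dominatesSquare_binary (d := 2) hc hc0 ⟨_, hx⟩
    exact ⟨_, hq.comp_tail, ⟨Fin.cons 0 w, by simpa using hw⟩, fun x => hqc _⟩
  · have hbv : b v = 0 := by
      have := hdisc v
      rw [hav, zero_mul] at this
      exact pow_eq_zero_iff two_ne_zero |>.mp (le_antisymm this (sq_nonneg _))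
    obtain ⟨g, hg, hbg⟩ := hb.exists_eq_cross_mul hv hbv
    have hgc : ∀ w, 0 ≤ e * c w - g w ^ 2 := by
      refine ((hc.smul e).sub (hg.pow 2)).nonneg_of_nonneg_of_ne_zero (isForm_cross v) hu ?_
      intro w hw
      have := hdisc w
      rw [hbg, har, he] at this
      have h2 : 0 < cross v w ^ 2 := by positivity
      refine (mul_nonneg_iff_of_pos_left h2).mp ?_
      linarith
    refine .of_mul (inv_pos.mpr hepos)
      (isForm_mul_zero_add ((isForm_cross v).smul e) hg)
      (u := Fin.cons ((1 - g u) / (e * cross v u)) u) ?_ fun x => ?_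
    · have : e * cross v u ≠ 0 := mul_ne_zero hepos.ne' hu
      simp only [Fin.cons_zero, Fin.tail_cons]
      rw [div_mul_cancel₀ _ this]
      norm_num
    · rw [inv_mul_le_iff₀ hepos, quadIn, har, hbg, he]
      nlinarith [hgc (Fin.tail x)]

/-- The leading coefficient `a` and the discriminant `a c - b ^ 2` are positive definite. -/
theorem dominatesSquare_of_discr_pos (ha : IsForm 2 a) (hb : IsForm 3 b) (hc : IsForm 4 c)
    (hnn : ∀ x, 0 ≤ quadIn a b c x) (hapos : ∀ w, w ≠ 0 → 0 < a w)
    (hD : ∀ w, w ≠ 0 → 0 < a w * c w - b w ^ 2) : DominatesSquare 2 (quadIn a b c) := by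
  obtain ⟨ε, hε, h⟩ := ((ha.mul hc).sub (hb.pow 2)).exists_pos_mul_le (ha.pow 3) hD
  have hone : (fun _ => 1 : Fin 2 → ℝ) ≠ 0 := fun h => one_ne_zero (congrFun h 0)
  refine .of_mul hε ha.comp_tail (u := Fin.cons 0 fun _ => 1) ?_ fun x => ?_
  · simpa using (hapos _ hone).ne'
  · set w := Fin.tail x with hw
    rcases (leadingCoeff_nonneg_of_quadIn_nonneg hnn w).eq_or_lt with h0 | h0
    · rw [← h0]
      simpa using hnn x
    · refine le_of_mul_le_mul_left ?_ h0
      rw [quadIn, ← hw]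
      nlinarith [h w, sq_nonneg (x 0 * a w + b w)]

/-- The form vanishes at `(1, 0, 0)` and at a point over the zero of the linear form `l`, and its
discriminant divided by `l ^ 2` is positive definite. -/
theorem dominatesSquare_of_reducedDiscr_pos {l g h : (Fin 2 → ℝ) → ℝ} (hl : IsForm 1 l)
    (hl0 : ∃ u, l u ≠ 0) (ha : IsForm 2 a) (hg : IsForm 2 g) (hh : IsForm 2 h)
    (hnn : ∀ x, 0 ≤ quadIn a (fun w => l w * g w) (fun w => l w ^ 2 * h w) x)
    (hapos : ∀ w, w ≠ 0 → 0 < a w) (hD : ∀ w, w ≠ 0 → 0 < a w * h w - g w ^ 2) :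
    DominatesSquare 2 (quadIn a (fun w => l w * g w) (fun w => l w ^ 2 * h w)) := by
  obtain ⟨ε, hε, hle⟩ := ((ha.mul hh).sub (hg.pow 2)).exists_pos_mul_le (ha.mul (hl.pow 2)) hD
  obtain ⟨u, hu⟩ := hl0
  refine .of_mul hε (hl.pow 2).comp_tail (u := Fin.cons 0 u) (by simpa using hu) fun x => ?_
  set w := Fin.tail x with hw
  rcases (leadingCoeff_nonneg_of_quadIn_nonneg hnn w).eq_or_lt with h0 | h0
  · have hw0 : w = 0 := by
      by_contra hw0
      exact (hapos w hw0).ne h0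
    have hlw : l w = 0 := by
      rw [hw0]
      simpa using hl.homogeneous 0 0
    simpa [hlw] using hnn x
  · refine le_of_mul_le_mul_left ?_ h0
    rw [quadIn, ← hw]
    nlinarith [mul_le_mul_of_nonneg_left (hle w) (sq_nonneg (l w)),
      sq_nonneg (x 0 * a w + l w * g w)]

/-- The form is homogeneous and quadratic in `(s, l m)`, where `s` is the first variable, with
coefficients `a`, `g` and the constant `e`: complete the square with respect to `l m`. -/
theorem dominatesSquare_of_reducedDiscr_zero {l m g : (Fin 2 → ℝ) → ℝ} {e : ℝ} (hl : IsForm 1 l)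
    (hm : IsForm 1 m) (hl0 : ∃ u, l u ≠ 0) (hm0 : ∃ u, m u ≠ 0) (ha : IsForm 2 a)
    (hg : IsForm 1 g) (he : 0 ≤ e) (hapos : ∀ w, w ≠ 0 → 0 < a w)
    (hD : ∀ w, 0 ≤ a w * e - g w ^ 2) :
    DominatesSquare 2
      (quadIn a (fun w => l w * (m w * g w)) (fun w => l w ^ 2 * (m w ^ 2 * e))) := by
  rcases he.eq_or_lt with rfl | hepos
  · -- then `g = 0`, and only the summand `s ^ 2 * a` remains
    have hg0 : ∀ w, g w = 0 := fun w => by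
      have := hD w
      exact pow_eq_zero_iff two_ne_zero |>.mp (le_antisymm (by linarith) (sq_nonneg _))
    obtain ⟨ε, hε, hle⟩ := ha.exists_pos_mul_le (hl.pow 2) hapos
    obtain ⟨u, hu⟩ := hl0
    refine .of_mul hε (hl.comp_tail.coord_mul 0) (u := Fin.cons 1 u) (by simpa using hu) ?_
    intro x
    simp only [quadIn, hg0]
    nlinarith [mul_le_mul_of_nonneg_left (hle (Fin.tail x)) (sq_nonneg (x 0))]
  · obtain ⟨u, hu, hu'⟩ := hm.exists_ne_zero_and_ne_zero hl hl0 hm0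
    refine .of_mul (inv_pos.mpr hepos)
      (isForm_mul_zero_add hg ((hl.mul hm).smul e)) (u := Fin.cons 0 u) ?_ fun x => ?_
    · simpa using ⟨hepos.ne', hu, hu'⟩
    · rw [inv_mul_le_iff₀ hepos, quadIn]
      nlinarith [mul_nonneg (sq_nonneg (x 0)) (hD (Fin.tail x))]

/-- The form vanishes at `(1, 0, 0)` and at a point over the zero of the linear form `l`. If the
discriminant divided by `l ^ 2` has a zero, a further shear moves the corresponding zero of the
form to `s = 0`, and the coefficients become divisible by a second linear form. -/
theorem dominatesSquare_of_leadingCoeff_pos_of_cross {l g h : (Fin 2 → ℝ) → ℝ} (hl : IsForm 1 l)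
    (hl0 : ∃ u, l u ≠ 0) (ha : IsForm 2 a) (hg : IsForm 2 g) (hh : IsForm 2 h)
    (hnn : ∀ x, 0 ≤ quadIn a (fun w => l w * g w) (fun w => l w ^ 2 * h w) x)
    (hapos : ∀ w, w ≠ 0 → 0 < a w) :
    DominatesSquare 2 (quadIn a (fun w => l w * g w) (fun w => l w ^ 2 * h w)) := by
  obtain ⟨u, hu⟩ := hl0
  have hD : ∀ w, 0 ≤ a w * h w - g w ^ 2 := by
    refine ((ha.mul hh).sub (hg.pow 2)).nonneg_of_nonneg_of_ne_zero hl hu fun w hw => ?_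
    have := sq_le_mul_of_quadIn_nonneg hnn w
    have h2 : 0 < l w ^ 2 := by positivity
    refine (mul_nonneg_iff_of_pos_left h2).mp ?_
    linarith
  by_cases hz : ∃ v, v ≠ 0 ∧ a v * h v - g v ^ 2 = 0
  swap
  · push Not at hz
    exact dominatesSquare_of_reducedDiscr_pos hl ⟨u, hu⟩ ha hg hh hnn hapos
      fun w hw => lt_of_le_of_ne (hD w) (hz w hw).symm
  obtain ⟨v, hv, hv0⟩ := hz
  have hav := hapos v hv
  -- the shear that moves the third zero to the first coordinate hyperplane
  set α := -g v / a v with hα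
  have hαv : g v + α * a v = 0 := by rw [hα]; field_simp; ring
  obtain ⟨p, hp, hgp⟩ := (hg.add (ha.smul α)).exists_eq_cross_mul hv hαv
  have hform : IsForm 2 fun w => h w + 2 * α * g w + α ^ 2 * a w :=
    (hh.add (hg.smul (2 * α))).add (ha.smul (α ^ 2))
  have hprod : ∀ w, a w * (h w + 2 * α * g w + α ^ 2 * a w) =
      (a w * h w - g w ^ 2) + (g w + α * a w) ^ 2 := fun w => by ring
  have hnn' : ∀ w, 0 ≤ h w + 2 * α * g w + α ^ 2 * a w := by
    refine hform.nonneg_of_nonneg_of_ne_zero hl hu fun w hw => ?_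
    have hw0 : w ≠ 0 := by
      rintro rfl
      exact hw (by simpa using hl.homogeneous 0 0)
    refine (mul_nonneg_iff_of_pos_left (hapos w hw0)).mp ?_
    rw [hprod]
    exact add_nonneg (hD w) (sq_nonneg _)
  have hhv : h v + 2 * α * g v + α ^ 2 * a v = 0 := by
    have := hprod v
    rw [hv0, hαv] at this
    simpa [hav.ne'] using this
  obtain ⟨r, ⟨e, he⟩, hr0, hhr⟩ := IsForm.exists_eq_cross_sq_mul (k := 0) hform hnn' hv hhv
  have he0 : 0 ≤ e := by rw [← he 0]; exact hr0 0
  obtain ⟨u', hu'⟩ := exists_cross_ne_zero hv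
  have hDp : ∀ w, 0 ≤ a w * e - p w ^ 2 := by
    refine ((ha.mul (IsForm.const e)).sub (hp.pow 2)).nonneg_of_nonneg_of_ne_zero
      (isForm_cross v) hu' fun w hw => ?_
    have h1 := hD w
    have h2 : a w * h w - g w ^ 2 = cross v w ^ 2 * (a w * e - p w ^ 2) := by
      have h3 := hprod w
      rw [hhr, hgp, he] at h3
      linarith
    rw [h2] at h1
    exact nonneg_of_mul_nonneg_right h1 (by positivity)
  refine DominatesSquare.of_shear (hl.smul α) (fun _ => ?_) hnn
  convert dominatesSquare_of_reducedDiscr_zero hl (isForm_cross v) ⟨u, hu⟩ ⟨u', hu'⟩ ha hp he0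
    hapos hDp using 2
  · funext w
    rw [← hgp]
    ring
  · funext w
    rw [← he w, ← hhr]
    ring

theorem dominatesSquare_of_leadingCoeff_pos (ha : IsForm 2 a) (hb : IsForm 3 b) (hc : IsForm 4 c)
    (hnn : ∀ x, 0 ≤ quadIn a b c x) (hapos : ∀ w, w ≠ 0 → 0 < a w) :
    DominatesSquare 2 (quadIn a b c) := by
  by_cases hz : ∃ v, v ≠ 0 ∧ a v * c v - b v ^ 2 = 0
  swap
  · push Not at hz
    exact dominatesSquare_of_discr_pos ha hb hc hnn hapos fun w hw =>
      lt_of_le_of_ne (by linarith [sq_le_mul_of_quadIn_nonneg hnn w]) (hz w hw).symm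
  obtain ⟨v, hv, hv0⟩ := hz
  have hav := hapos v hv
  have hN := sq_add_sq_pos hv
  -- the shear that moves the second zero `(-b v / a v, v)` to `(0, v)`
  let L : (Fin 2 → ℝ) → ℝ := fun w =>
    (-b v / a v / (v 0 ^ 2 + v 1 ^ 2)) * (v 0 * w 0 + v 1 * w 1)
  have hL : IsForm 1 L := (((IsForm.coord 0).smul (v 0)).add ((IsForm.coord 1).smul (v 1))).smul _
  have hLv : L v = -b v / a v := by
    simp only [L]
    rw [← pow_two, ← pow_two, div_mul_cancel₀ _ hN.ne']
  refine DominatesSquare.of_shear hL (fun hnn' => ?_) hnn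
  have hb' : IsForm 3 fun w => b w + L w * a w := hb.add (hL.mul ha)
  have hc' : IsForm 4 fun w => c w + 2 * L w * b w + L w ^ 2 * a w :=
    (hc.add ((hL.smul 2).mul hb)).add ((hL.pow 2).mul ha)
  have hbv : b v + L v * a v = 0 := by
    rw [hLv]
    field_simp
    ring
  have hcv : c v + 2 * L v * b v + L v ^ 2 * a v = 0 := by
    rw [hLv]
    field_simp
    linarith
  obtain ⟨g, hg, hbg⟩ := hb'.exists_eq_cross_mul hv hbv
  obtain ⟨h, hh, -, hch⟩ := IsForm.exists_eq_cross_sq_mul (k := 2) hc'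
    (nonneg_of_quadIn_nonneg hnn') hv hcv
  rw [funext hbg, funext hch] at hnn' ⊢
  exact dominatesSquare_of_leadingCoeff_pos_of_cross (isForm_cross v) (exists_cross_ne_zero hv)
    ha hg hh hnn' hapos

/-- A nonnegative ternary quartic with a zero is moved by a change of coordinates to one with the
zero `(1, 0, 0)`, hence quadratic in the first variable. -/
theorem dominatesSquare_ternary_quartic {F : (Fin 3 → ℝ) → ℝ} (hF : IsForm 4 F)
    (hnn : ∀ x, 0 ≤ F x) (hne : ∃ x, F x ≠ 0) : DominatesSquare 2 F := by
  by_cases hz : ∃ v, v ≠ 0 ∧ F v = 0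
  swap
  · push Not at hz
    exact .of_pos hF fun x hx => lt_of_le_of_ne (hnn x) (hz x hx).symm
  obtain ⟨v, hv, hFv⟩ := hz
  obtain ⟨A, hA⟩ := SeparatingDual.exists_continuousLinearEquiv_apply_eq (R := ℝ)
    (x := (Pi.single 0 1 : Fin 3 → ℝ)) (y := v) (by simp) hv
  refine .of_comp A.toLinearEquiv ?_
  have hne' : ∃ x, F (A.toLinearEquiv x) ≠ 0 := by
    obtain ⟨x, hx⟩ := hne
    exact ⟨A.symm x, by simpa using hx⟩
  obtain ⟨a, b, c, ha, hb, hc, hquad⟩ := IsForm.exists_eq_quadIn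
    (hF.comp A.toLinearEquiv.toLinearMap) (fun x => hnn _) (by simpa [hA] using hFv)
  have hquad' : (fun x => F (A.toLinearEquiv x)) = quadIn a b c := hquad
  have hnn' : ∀ x, 0 ≤ quadIn a b c x := fun x => by rw [← hquad']; exact hnn _
  rw [hquad']
  by_cases ha0 : ∃ v, v ≠ 0 ∧ a v = 0
  · obtain ⟨v, hv, hav⟩ := ha0
    exact dominatesSquare_of_leadingCoeff_zero ha hb hc hnn'
      (by simpa only [← hquad'] using hne') hv hav
  · push Not at ha0
    exact dominatesSquare_of_leadingCoeff_pos ha hb hc hnn' fun w hw =>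
      lt_of_le_of_ne (leadingCoeff_nonneg_of_quadIn_nonneg hnn' w) (ha0 w hw).symm

end ternary

/-- A nonnegative quadratic form `f` with `f v > 0` dominates `B(x, v)² / f v`, where `B` is its
polar form: this is the Cauchy-Schwarz inequality. -/
theorem dominatesSquare_quadratic {ι : Type} [Fintype ι] {f : (ι → ℝ) → ℝ} (hf : IsForm 2 f)
    (hnn : ∀ x, 0 ≤ f x) (hne : ∃ x, f x ≠ 0) : DominatesSquare 1 f := by
  obtain ⟨v, hv⟩ := hne
  have hfv : 0 < f v := lt_of_le_of_ne (hnn v) hv.symm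
  obtain ⟨g, hg, hfg⟩ := hf
  choose A hA using fun i => (hg i).exists_linearMap
  -- twice the polar form
  let B : (ι → ℝ) → ℝ := fun x => ∑ i, (x i * A i v + v i * A i x)
  have hB : IsForm 1 B := IsForm.sum _ fun i _ => by
    simpa only [mul_comm] using
      ((IsForm.coord i).smul (A i v)).add ((IsForm.linear (A i)).smul (v i))
  have hexp : ∀ x (t : ℝ), f (x + t • v) = f v * (t * t) + B x * t + f x := fun x t => by
    simp only [hfg, hA, B, Pi.add_apply, Pi.smul_apply, map_add, map_smul, smul_eq_mul,
      Finset.sum_mul, ← Finset.sum_add_distrib]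
    exact Finset.sum_congr rfl fun i _ => by ring
  have hBv : B v = 2 * f v := by
    simp only [hfg, hA, B, Finset.mul_sum]
    exact Finset.sum_congr rfl fun i _ => by ring
  refine .of_mul (c := (4 * f v)⁻¹) (by positivity) hB (u := v) (by rw [hBv]; positivity)
    fun x => ?_
  have := discrim_le_zero fun t => (hnn (x + t • v)).trans_eq (hexp x t)
  rw [discrim] at this
  rw [inv_mul_le_iff₀ (by positivity)]
  linarith

/-! ### Compactness of convex hulls, and coordinates for forms and moments -/

/-- In finite dimension the convex hull of a compact set is compact: by Carathéodory's theorem it is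
a finite union of images of the compact sets `stdSimplex ℝ (Fin n) × S ^ n`. -/
theorem isCompact_convexHull {E : Type*} [NormedAddCommGroup E] [NormedSpace ℝ E]
    [FiniteDimensional ℝ E] {S : Set E} (hS : IsCompact S) : IsCompact (convexHull ℝ S) := by
  let K : ℕ → Set E := fun n => (fun p : (Fin n → ℝ) × (Fin n → E) => ∑ i, p.1 i • p.2 i) ''
    (stdSimplex ℝ (Fin n) ×ˢ Set.univ.pi fun _ => S)
  have hK : ∀ n, IsCompact (K n) := fun n =>
    ((isCompact_stdSimplex ℝ (Fin n)).prod (isCompact_univ_pi fun _ => hS)).image (by fun_prop)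
  suffices convexHull ℝ S = ⋃ n ∈ Finset.range (Module.finrank ℝ E + 2), K n by
    rw [this]
    exact (Finset.range _).isCompact_biUnion fun n _ => hK n
  refine Set.Subset.antisymm (fun x hx => ?_) (Set.iUnion₂_subset fun n _ => ?_)
  · obtain ⟨ι, _, z, w, hz, hind, hw, hw1, rfl⟩ := eq_pos_convex_span_of_mem_convexHull hx
    have hcard := hind.card_le_finrank_succ
    have hle : Module.finrank ℝ (vectorSpan ℝ (Set.range z)) ≤ Module.finrank ℝ E :=
      Submodule.finrank_le _
    let e := (Fintype.equivFin ι).symm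
    refine Set.mem_iUnion₂.mpr ⟨Fintype.card ι, Finset.mem_range.mpr (by omega), ?_⟩
    refine ⟨(w ∘ e, z ∘ e), ⟨⟨fun i => (hw _).le, ?_⟩, fun i _ => hz ⟨e i, rfl⟩⟩, ?_⟩
    · rw [← hw1]
      exact e.sum_comp w
    · exact e.sum_comp fun i => w i • z i
  · rintro _ ⟨⟨w, z⟩, ⟨hw, hz⟩, rfl⟩
    exact (convex_convexHull ℝ S).sum_mem (fun i _ => hw.1 i) hw.2
      fun i _ => subset_convexHull ℝ S (hz i trivial)

section zeta

variable {m k d : ℕ}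

instance : Finite (MultiIndex m k) :=
  ((Set.finite_Iic fun _ => k).subset fun _ hα i =>
    (Finset.single_le_sum (fun _ _ => Nat.zero_le _) (Finset.mem_univ i)).trans hα :
    {α : Fin m → ℕ | ∑ i, α i ≤ k}.Finite)

instance : Fintype (MultiIndex m k) := Fintype.ofFinite _

theorem exists_coord_mul_zeta_eq (i : Fin (m + 1)) (α : MultiIndex m k) :
    ∃ β : MultiIndex m (k + 1), ∀ x, x i * zeta m k x α = zeta m (k + 1) x β := by
  have hα := α.2
  induction i using Fin.cases with
  | zero =>
    refine ⟨⟨α.1, by omega⟩, fun x => ?_⟩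
    simp only [zeta]
    rw [Nat.sub_add_comm hα, pow_succ]
    ring
  | succ i =>
    refine ⟨⟨α.1 + Pi.single i 1, by simp [Finset.sum_add_distrib, hα]⟩, fun x => ?_⟩
    simp only [zeta, Pi.add_apply, Finset.sum_add_distrib, Finset.sum_pi_single',
      Finset.mem_univ, if_true, Nat.add_sub_add_right, pow_add, Finset.prod_mul_distrib]
    rw [Finset.prod_eq_single (f := fun j => x j.succ ^ (Pi.single i 1 : Fin m → ℕ) j) i]
    · simp
      ring
    · intro j _ hj
      simp [hj]
    · simp

theorem isForm_zeta (α : MultiIndex m k) : IsForm k (fun x => zeta m k x α) := by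
  have h1 : IsForm (k - ∑ i, α.1 i) (fun x : Fin (m + 1) → ℝ => x 0 ^ (k - ∑ i, α.1 i)) := by
    simpa using (IsForm.coord 0).pow _
  have h2 : IsForm (∑ i, α.1 i) (fun x : Fin (m + 1) → ℝ => ∏ i : Fin m, x i.succ ^ α.1 i) :=
    IsForm.prod _ fun i _ => by simpa using (IsForm.coord i.succ).pow (α.1 i)
  have := h1.mul h2
  rwa [Nat.sub_add_cancel α.2] at this

theorem isForm_dotProduct_zeta (c : MultiIndex m k → ℝ) : IsForm k (fun x => c ⬝ᵥ zeta m k x) :=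
  IsForm.sum _ fun α _ => (isForm_zeta α).smul (c α)

theorem IsForm.exists_eq_dotProduct_zeta {f : (Fin (m + 1) → ℝ) → ℝ} (hf : IsForm k f) :
    ∃ c : MultiIndex m k → ℝ, ∀ x, f x = c ⬝ᵥ zeta m k x := by
  suffices f ∈ Submodule.span ℝ (Set.range fun (α : MultiIndex m k) x => zeta m k x α) by
    obtain ⟨c, hc⟩ := (Submodule.mem_span_range_iff_exists_fun ℝ).mp this
    exact ⟨c, fun x => by rw [← hc]; simp [dotProduct]⟩
  induction k generalizing f with
  | zero =>
    obtain ⟨c, hc⟩ := hf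
    have : f = c • fun x => zeta m 0 x (MultiIndex.zero m 0) := by
      funext x
      simp [hc, zeta, MultiIndex.zero]
    rw [this]
    exact Submodule.smul_mem _ _ (Submodule.subset_span ⟨_, rfl⟩)
  | succ k ih =>
    obtain ⟨g, hg, hfg⟩ := hf
    have : f = ∑ i, (fun x => x i) * g i := by
      funext x
      simp [hfg]
    rw [this]
    refine Submodule.sum_mem _ fun i _ => ?_
    refine Submodule.span_induction (p := fun h _ => (fun x => x i) * h ∈ Submodule.span ℝ
      (Set.range fun (α : MultiIndex m (k + 1)) x => zeta m (k + 1) x α)) ?_ ?_ ?_ ?_ (ih (hg i))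
    · rintro _ ⟨α, rfl⟩
      obtain ⟨β, hβ⟩ := exists_coord_mul_zeta_eq i α
      exact Submodule.subset_span ⟨β, funext fun x => (hβ x).symm⟩
    · simp
    · intro p q _ _ hp hq
      rw [mul_add]
      exact Submodule.add_mem _ hp hq
    · intro r p _ hp
      rw [mul_smul_comm]
      exact Submodule.smul_mem _ _ hp

/-- A form is determined by its values. -/
theorem eq_zero_of_forall_dotProduct_zeta {c : MultiIndex m k → ℝ}
    (hc : ∀ x, c ⬝ᵥ zeta m k x = 0) : c = 0 := by
  classical
  let p : MvPolynomial (Fin m) ℝ :=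
    ∑ α, MvPolynomial.monomial (Finsupp.equivFunOnFinite.symm α.1) (c α)
  have hp : p = 0 := MvPolynomial.funext fun x => by
    have := hc (Fin.cons 1 x)
    simp only [dotProduct, zeta, Fin.cons_zero, one_pow, one_mul, Fin.cons_succ] at this
    rw [map_zero, ← this, map_sum]
    refine Finset.sum_congr rfl fun α _ => ?_
    rw [MvPolynomial.eval_monomial, Finsupp.prod_fintype _ _ fun i => pow_zero _]
    simp
  funext α
  have := congrArg (MvPolynomial.coeff (Finsupp.equivFunOnFinite.symm α.1)) hp
  rw [MvPolynomial.coeff_sum, Finset.sum_eq_single α] at this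
  · simpa using this
  · intro β _ hβ
    rw [MvPolynomial.coeff_monomial, if_neg]
    intro h
    exact hβ (Subtype.ext (Finsupp.equivFunOnFinite.symm.injective h))
  · simp

theorem linearMap_eq_dotProduct {ι : Type} [Fintype ι] [DecidableEq ι] (f : (ι → ℝ) →ₗ[ℝ] ℝ)
    (v : ι → ℝ) : f v = (fun i => f (Pi.single i 1)) ⬝ᵥ v := by
  conv_lhs => rw [pi_eq_sum_univ' v]
  simp [map_sum, dotProduct, mul_comm]

/-- The moment vectors span, so that finitely many point evaluations separate forms. -/
theorem span_range_zeta : Submodule.span ℝ (Set.range (zeta m k)) = ⊤ := by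
  classical
  by_contra h
  obtain ⟨f, hf0, hf⟩ := Submodule.exists_le_ker_of_lt_top _ (lt_top_iff_ne_top.mpr h)
  have hfv := linearMap_eq_dotProduct f
  have hc : (fun α => f (Pi.single α 1)) = 0 := eq_zero_of_forall_dotProduct_zeta fun x => by
    rw [← hfv]
    exact hf (Submodule.subset_span ⟨x, rfl⟩)
  refine hf0 (LinearMap.ext fun v => ?_)
  rw [hfv, hc]
  simp

theorem zeta_add (x : Fin (m + 1) → ℝ) (α β : MultiIndex m d) :
    zeta m (2 * d) x (α.add β) = zeta m d x α * zeta m d x β := by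
  have hα := α.2
  have hβ := β.2
  simp only [zeta, MultiIndex.add, Finset.sum_add_distrib, pow_add, Finset.prod_mul_distrib]
  rw [show 2 * d - (∑ i, α.1 i + ∑ i, β.1 i) = (d - ∑ i, α.1 i) + (d - ∑ i, β.1 i) by omega,
    pow_add]
  ring

theorem exists_le_sum_eq (γ : Fin m → ℕ) {n : ℕ} (hn : n ≤ ∑ i, γ i) :
    ∃ α ≤ γ, ∑ i, α i = n := by
  induction n with
  | zero => exact ⟨0, fun _ => Nat.zero_le _, by simp⟩
  | succ n ih =>
    obtain ⟨α, hα, hαn⟩ := ih (by omega)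
    obtain ⟨i, -, hi⟩ := Finset.exists_lt_of_sum_lt (s := Finset.univ) (f := α) (g := γ) (by omega)
    refine ⟨α + Pi.single i 1, fun j => ?_, by simp [Finset.sum_add_distrib, hαn]⟩
    by_cases hj : j = i
    · subst hj
      simpa using hi
    · simpa [hj] using hα j

theorem MultiIndex.exists_add_eq (γ : MultiIndex m (2 * d)) :
    ∃ α β : MultiIndex m d, α.add β = γ := by
  obtain ⟨α, hα, hαn⟩ := exists_le_sum_eq γ.1 (min_le_right d _)
  have hsum : ∑ i, (γ.1 i - α i) + ∑ i, α i = ∑ i, γ.1 i := by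
    rw [← Finset.sum_add_distrib]
    exact Finset.sum_congr rfl fun i _ => Nat.sub_add_cancel (hα i)
  have hγ := γ.2
  refine ⟨⟨α, by omega⟩, ⟨fun i => γ.1 i - α i, ?_⟩, Subtype.ext (funext fun i => ?_)⟩
  · show ∑ i, (γ.1 i - α i) ≤ d
    omega
  · exact Nat.add_sub_cancel' (hα i)

theorem momentMatrix_add (y z : MultiIndex m (2 * d) → ℝ) :
    momentMatrix m d (y + z) = momentMatrix m d y + momentMatrix m d z := rfl

theorem momentMatrix_smul (r : ℝ) (y : MultiIndex m (2 * d) → ℝ) :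
    momentMatrix m d (r • y) = r • momentMatrix m d y := rfl

theorem momentMatrix_injective : Function.Injective (momentMatrix m d) := fun y z h => by
  funext γ
  obtain ⟨α, β, rfl⟩ := γ.exists_add_eq
  exact congrFun (congrFun h α) β

theorem momentMatrix_zeta (x : Fin (m + 1) → ℝ) :
    momentMatrix m d (zeta m (2 * d) x) = Matrix.vecMulVec (zeta m d x) (zeta m d x) := by
  ext α β
  simp [momentMatrix, zeta_add, Matrix.vecMulVec_apply]

theorem posSemidef_momentMatrix_zeta (x : Fin (m + 1) → ℝ) :
    (momentMatrix m d (zeta m (2 * d) x)).PosSemidef := by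
  rw [momentMatrix_zeta]
  simpa using Matrix.posSemidef_vecMulVec_self_star (zeta m d x)

/-- The coefficients of the square of the form with coefficients `q`. -/
def sqCoeff (q : MultiIndex m d → ℝ) : MultiIndex m (2 * d) → ℝ := by
  classical
  exact fun γ => ∑ p : MultiIndex m d × MultiIndex m d with p.1.add p.2 = γ, q p.1 * q p.2

theorem sqCoeff_dotProduct (q : MultiIndex m d → ℝ) (y : MultiIndex m (2 * d) → ℝ) :
    sqCoeff q ⬝ᵥ y = q ⬝ᵥ (momentMatrix m d y).mulVec q := by
  classical
  have h1 : sqCoeff q ⬝ᵥ y = ∑ p : MultiIndex m d × MultiIndex m d,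
      q p.1 * q p.2 * y (p.1.add p.2) := by
    rw [← Finset.sum_fiberwise Finset.univ fun p : MultiIndex m d × MultiIndex m d => p.1.add p.2]
    refine Finset.sum_congr rfl fun γ _ => ?_
    rw [sqCoeff, Finset.sum_mul]
    refine Finset.sum_congr rfl fun p hp => ?_
    rw [(Finset.mem_filter.mp hp).2]
  rw [h1, Fintype.sum_prod_type]
  simp only [dotProduct, Matrix.mulVec, momentMatrix, Matrix.of_apply, Finset.mul_sum]
  exact Finset.sum_congr rfl fun α _ => Finset.sum_congr rfl fun β _ => by ring

theorem sqCoeff_dotProduct_zeta (q : MultiIndex m d → ℝ) (x : Fin (m + 1) → ℝ) :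
    sqCoeff q ⬝ᵥ zeta m (2 * d) x = (q ⬝ᵥ zeta m d x) ^ 2 := by
  rw [sqCoeff_dotProduct, momentMatrix_zeta, Matrix.vecMulVec_mulVec]
  simp [dotProduct_comm, pow_two]

end zeta

/-! ### Duality -/

variable {m d : ℕ}

/-- If every nonzero nonnegative form of degree `2 d` dominates a square, then a moment sequence
with positive semidefinite moment matrix is nonnegative on all nonnegative forms.

Otherwise some nonnegative form `c` satisfies `c ⬝ᵥ y < 0`. The forms `g` with `0 ≤ g ≤ c` and
`g ⬝ᵥ y ≤ c ⬝ᵥ y` form a compact set, which does not contain `0`. On this set, minimize a sum of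
point evaluations that separates forms; subtracting a square dominated by the minimizer yields
a smaller element of the set. -/
theorem dotProduct_nonneg_of_posSemidef
    (hP : ∀ f : (Fin (m + 1) → ℝ) → ℝ, IsForm (2 * d) f → (∀ x, 0 ≤ f x) → (∃ x, f x ≠ 0) →
      DominatesSquare d f)
    {y : MultiIndex m (2 * d) → ℝ} (hy : (momentMatrix m d y).PosSemidef)
    {c : MultiIndex m (2 * d) → ℝ} (hc : ∀ x, 0 ≤ c ⬝ᵥ zeta m (2 * d) x) : 0 ≤ c ⬝ᵥ y := by
  by_contra! hcy
  obtain ⟨t, ht, hspan⟩ := (Submodule.fg_span_iff_fg_span_finset_subset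
    (Set.range (zeta m (2 * d)))).mp (IsNoetherian.noetherian (R := ℝ) _)
  rw [span_range_zeta] at hspan
  -- the values of a form at finitely many points that separate forms
  let A : (MultiIndex m (2 * d) → ℝ) →ₗ[ℝ] (t → ℝ) := Matrix.mulVecLin (Matrix.of fun v α => v.1 α)
  have hA : ∀ g v, A g v = g ⬝ᵥ v.1 := fun g v => dotProduct_comm _ _
  have hA0 : ∀ g, A g = 0 → g = 0 := fun g hg => by
    refine dotProduct_eq_zero _ fun w => ?_
    have hw : w ∈ Submodule.span ℝ (t : Set (MultiIndex m (2 * d) → ℝ)) := hspan ▸ trivial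
    induction hw using Submodule.span_induction with
    | mem v hv => rw [← hA g ⟨v, hv⟩, hg, Pi.zero_apply]
    | zero => simp
    | add v w _ _ hv hw => rw [dotProduct_add, hv, hw, add_zero]
    | smul r v _ hv => rw [dotProduct_smul, hv, smul_zero]
  have hAt : ∀ v : t, ∃ x, zeta m (2 * d) x = v.1 := fun v => ht v.2
  let K : Set (MultiIndex m (2 * d) → ℝ) :=
    {g | (∀ x, 0 ≤ g ⬝ᵥ zeta m (2 * d) x) ∧
      (∀ x, g ⬝ᵥ zeta m (2 * d) x ≤ c ⬝ᵥ zeta m (2 * d) x) ∧ g ⬝ᵥ y ≤ c ⬝ᵥ y}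
  have hdot : ∀ v : MultiIndex m (2 * d) → ℝ, Continuous fun g => g ⬝ᵥ v := fun v =>
    continuous_id.dotProduct continuous_const
  have hKclosed : IsClosed K := by
    have h1 : IsClosed {g | ∀ x, 0 ≤ g ⬝ᵥ zeta m (2 * d) x} := by
      simp only [Set.ofPred_forall]
      exact isClosed_iInter fun x => isClosed_le continuous_const (hdot _)
    have h2 : IsClosed {g | ∀ x, g ⬝ᵥ zeta m (2 * d) x ≤ c ⬝ᵥ zeta m (2 * d) x} := by
      simp only [Set.ofPred_forall]
      exact isClosed_iInter fun x => isClosed_le (hdot _) continuous_const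
    exact h1.inter (h2.inter (isClosed_le (hdot y) continuous_const))
  have hK : IsCompact K := by
    have hemb := A.isClosedEmbedding_of_injective (LinearMap.ker_eq_bot'.mpr hA0)
    refine (hemb.isCompact_preimage (isCompact_Icc (a := 0) (b := A c))).of_isClosed_subset
      hKclosed fun g hg => ⟨fun v => ?_, fun v => ?_⟩
    · obtain ⟨x, hx⟩ := hAt v
      rw [hA, ← hx]
      exact hg.1 x
    · obtain ⟨x, hx⟩ := hAt v
      rw [hA, hA, ← hx]
      exact hg.2.1 x
  obtain ⟨g, ⟨hg0, hgc, hgy⟩, hmin⟩ := hK.exists_isMinOn ⟨c, hc, fun _ => le_rfl, le_rfl⟩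
    (f := fun g => ∑ v, A g v)
    (continuous_finsetSum _ fun v _ =>
      (continuous_apply v).comp A.continuous_of_finiteDimensional).continuousOn
  have hgne : ∃ x, g ⬝ᵥ zeta m (2 * d) x ≠ 0 := by
    by_contra! h
    rw [eq_zero_of_forall_dotProduct_zeta h, zero_dotProduct] at hgy
    linarith
  obtain ⟨q, hq, ⟨u, hu⟩, hqg⟩ := hP _ (isForm_dotProduct_zeta g) hg0 hgne
  obtain ⟨b, hb⟩ := hq.exists_eq_dotProduct_zeta
  have hsq : ∀ x, sqCoeff b ⬝ᵥ zeta m (2 * d) x = q x ^ 2 := fun x => by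
    rw [sqCoeff_dotProduct_zeta, hb]
  have hmem : g - sqCoeff b ∈ K := by
    refine ⟨fun x => ?_, fun x => ?_, ?_⟩
    · rw [sub_dotProduct, hsq]
      linarith [hqg x]
    · rw [sub_dotProduct, hsq]
      linarith [hgc x, sq_nonneg (q x)]
    · rw [sub_dotProduct, sqCoeff_dotProduct]
      have := hy.dotProduct_mulVec_nonneg b
      rw [star_trivial] at this
      linarith
  have hnn : ∀ v ∈ Finset.univ, 0 ≤ A (sqCoeff b) v := fun v _ => by
    obtain ⟨x, hx⟩ := hAt v
    rw [hA, ← hx, hsq]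
    exact sq_nonneg _
  have hle : ∑ v, A g v ≤ ∑ v, A (g - sqCoeff b) v := hmin hmem
  simp only [map_sub, Pi.sub_apply, Finset.sum_sub_distrib] at hle
  have hsum : ∑ v, A (sqCoeff b) v = 0 := le_antisymm (by linarith) (Finset.sum_nonneg hnn)
  have hb0 : sqCoeff b = 0 := hA0 _ <| funext fun v =>
    (Finset.sum_eq_zero_iff_of_nonneg hnn).mp hsum v (Finset.mem_univ v)
  have := hsq u
  rw [hb0, zero_dotProduct] at this
  exact hu (pow_eq_zero_iff two_ne_zero |>.mp this.symm)

/-- The trace of the moment matrix, a linear functional that is positive on the nonzero moment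
sequences considered here; it normalizes them to an affine hyperplane. -/
def momentTrace (m d : ℕ) : (MultiIndex m (2 * d) → ℝ) →ₗ[ℝ] ℝ where
  toFun y := (momentMatrix m d y).trace
  map_add' y z := by rw [momentMatrix_add, Matrix.trace_add]
  map_smul' r y := by rw [momentMatrix_smul, Matrix.trace_smul, RingHom.id_apply]

theorem momentTrace_pos {y : MultiIndex m (2 * d) → ℝ} (hy : (momentMatrix m d y).PosSemidef)
    (hy0 : y ≠ 0) : 0 < momentTrace m d y := by
  refine lt_of_le_of_ne hy.trace_nonneg fun h => hy0 (momentMatrix_injective ?_)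
  rw [hy.trace_eq_zero_iff.mp h.symm]
  rfl

/-- The normalized moment vectors of the points of the unit sphere (of the sup norm). -/
def normalizedZeta (m d : ℕ) : Set (MultiIndex m (2 * d) → ℝ) :=
  (fun x => (momentTrace m d (zeta m (2 * d) x))⁻¹ • zeta m (2 * d) x) '' Metric.sphere 0 1

/-- A normalized vector outside the compact convex hull would be separated from it, by a
nonnegative form that takes a negative value on it. -/
theorem smul_mem_convexHull_of_posSemidef
    (hP : ∀ f : (Fin (m + 1) → ℝ) → ℝ, IsForm (2 * d) f → (∀ x, 0 ≤ f x) → (∃ x, f x ≠ 0) →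
      DominatesSquare d f)
    {y : MultiIndex m (2 * d) → ℝ} (hy : (momentMatrix m d y).PosSemidef) (hy0 : y ≠ 0) :
    (momentTrace m d y)⁻¹ • y ∈ convexHull ℝ (normalizedZeta m d) := by
  classical
  have htr := momentTrace_pos hy hy0
  have hpos : ∀ x ∈ Metric.sphere (0 : Fin (m + 1) → ℝ) 1,
      0 < momentTrace m d (zeta m (2 * d) x) := fun x hx =>
    momentTrace_pos (posSemidef_momentMatrix_zeta x)
      (zeta_ne_zero m _ (by rintro rfl; simp at hx))
  have hcont : Continuous (zeta m (2 * d)) := continuous_pi fun α => (isForm_zeta α).continuous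
  have hcompact : IsCompact (normalizedZeta m d) := by
    refine (isCompact_sphere 0 1).image_of_continuousOn
      (ContinuousOn.fun_smul ?_ hcont.continuousOn)
    exact ((momentTrace m d).continuous_of_finiteDimensional.comp hcont).continuousOn.inv₀
      fun x hx => (hpos x hx).ne'
  by_contra hmem
  obtain ⟨f, u, hfy, hfu⟩ := geometric_hahn_banach_point_closed (convex_convexHull ℝ _)
    (isCompact_convexHull hcompact).isClosed hmem
  -- the nonnegative form that separates `y`
  let F : (MultiIndex m (2 * d) → ℝ) →ₗ[ℝ] ℝ := f.toLinearMap - u • momentTrace m d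
  have hF : ∀ v, F v = f v - u * momentTrace m d v := fun v => by simp [F]
  have hFx : ∀ x, 0 ≤ (fun α => F (Pi.single α 1)) ⬝ᵥ zeta m (2 * d) x := fun x => by
    obtain ⟨t, ht, v, hv, rfl⟩ := exists_eq_smul_mem_sphere x
    have h1 := hfu _ (subset_convexHull ℝ _ ⟨v, hv, rfl⟩)
    rw [map_smul, smul_eq_mul, lt_inv_mul_iff₀ (hpos v hv)] at h1
    rw [← linearMap_eq_dotProduct, zeta_smul, map_smul, hF]
    exact mul_nonneg (pow_nonneg ht _) (by linarith)
  have h2 := dotProduct_nonneg_of_posSemidef hP hy hFx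
  rw [← linearMap_eq_dotProduct, hF] at h2
  rw [map_smul, smul_eq_mul, inv_mul_lt_iff₀ htr] at hfy
  linarith

/-! ### The oriented projective space -/

theorem rayOfNeZero_smul {ι : Type} {v : ι → ℝ} (hv : v ≠ 0) {r : ℝ} (hr : 0 < r)
    (hrv : r • v ≠ 0) : rayOfNeZero ℝ (r • v) hrv = rayOfNeZero ℝ v hv :=
  (ray_eq_iff _ _).mpr (SameRay.sameRay_pos_smul_left v hr)

theorem rayOfNeZero_mem_pointsOf {ι : Type} {C : Set (ι → ℝ)}
    (hC : ∀ v ∈ C, ∀ r : ℝ, 0 < r → r • v ∈ C) {v : ι → ℝ} (hv : v ≠ 0) :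
    rayOfNeZero ℝ v hv ∈ pointsOf C ↔ v ∈ C := by
  refine ⟨?_, fun h => ⟨v, hv, h, rfl⟩⟩
  rintro ⟨w, hw, hwC, h⟩
  obtain ⟨r, hr, rfl⟩ := SameRay.exists_pos_left ((ray_eq_iff _ _).mp h.symm) hw hv
  exact hC w hwC r hr

theorem rayOfNeZero_mem_nonnegPart {ι : Type} {i : ι} {v : ι → ℝ} (hv : v ≠ 0) :
    rayOfNeZero ℝ v hv ∈ nonnegPart i ↔ 0 ≤ v i :=
  rayOfNeZero_mem_pointsOf (fun _ hw _ hr => mul_nonneg hr.le hw) hv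

theorem rayOfNeZero_mem_Y {y : MultiIndex m (2 * d) → ℝ} (hy : y ≠ 0) :
    rayOfNeZero ℝ y hy ∈ Y m d ↔ 0 ≤ y (MultiIndex.zero m (2 * d)) ∧
      (momentMatrix m d y).PosSemidef :=
  and_congr (rayOfNeZero_mem_nonnegPart hy)
    (rayOfNeZero_mem_pointsOf (C := {y | (momentMatrix m d y).PosSemidef})
    (fun _ hw _ hr => Matrix.PosSemidef.smul hw hr.le) hy)

theorem isConvex_Y : IsConvex (Y m d) := by
  intro u v hu hv hyu hyv a b ha hb h
  rw [rayOfNeZero_mem_Y] at hyu hyv ⊢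
  refine ⟨add_nonneg (mul_nonneg ha hyu.1) (mul_nonneg hb hyv.1), ?_⟩
  rw [momentMatrix_add, momentMatrix_smul, momentMatrix_smul]
  exact (hyu.2.smul ha).add (hyv.2.smul hb)

theorem Z_subset_Y : Z m d ⊆ Y m d := by
  refine Set.sInter_subset_of_mem ⟨isConvex_Y, ?_⟩
  rintro _ ⟨h0, _, ⟨x, hx, -, rfl⟩, rfl⟩
  exact ⟨h0, _, zeta_ne_zero m _ hx, posSemidef_momentMatrix_zeta x, rfl⟩

/-- The cone over a convex set of rays, with the origin added, is convex. -/
theorem convex_setOf_rayOfNeZero_mem {ι : Type} {T : Set (OrientedProj ι)} (hT : IsConvex T) :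
    Convex ℝ {v : ι → ℝ | ∀ hv : v ≠ 0, rayOfNeZero ℝ v hv ∈ T} := by
  intro u hu v hv a b ha hb _ h
  rcases eq_or_ne u 0 with rfl | hu0 <;> rcases eq_or_ne v 0 with rfl | hv0
  · simp at h
  · simpa using hT v v hv0 hv0 (hv hv0) (hv hv0) 0 b le_rfl hb (by simpa using h)
  · simpa using hT u u hu0 hu0 (hu hu0) (hu hu0) a 0 ha le_rfl (by simpa using h)
  · exact hT u v hu0 hv0 (hu hu0) (hv hv0) a b ha hb h

/-- Every point `ζ(x)` belongs to `Z`: as the degree is even, the sign of `x` can be chosen. -/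
theorem rayOfNeZero_zeta_mem_Z {x : Fin (m + 1) → ℝ} (hx : x ≠ 0) :
    rayOfNeZero ℝ (zeta m (2 * d) x) (zeta_ne_zero m _ hx) ∈ Z m d := by
  wlog h0 : 0 ≤ x 0 generalizing x
  · have h := this (x := -x) (neg_ne_zero.mpr hx) (by simp only [Pi.neg_apply]; linarith)
    have hz : zeta m (2 * d) (-x) = zeta m (2 * d) x := by
      rw [← neg_one_smul ℝ x, zeta_smul]
      simp
    simpa only [hz] using h
  · refine fun T hT => hT.2 ⟨?_, rayOfNeZero ℝ x hx, ?_, (zetaProj_rayOfNeZero m _ x hx).symm⟩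
    · rw [rayOfNeZero_mem_nonnegPart]
      simpa [zeta, MultiIndex.zero] using pow_nonneg h0 _
    · rwa [rayOfNeZero_mem_nonnegPart]

theorem isConvex_Z : IsConvex (Z m d) := fun u v hu hv hzu hzv a b ha hb h T hT =>
  hT.1 u v hu hv (hzu T hT) (hzv T hT) a b ha hb h

theorem Y_subset_Z
    (hP : ∀ f : (Fin (m + 1) → ℝ) → ℝ, IsForm (2 * d) f → (∀ x, 0 ≤ f x) → (∃ x, f x ≠ 0) →
      DominatesSquare d f) : Y m d ⊆ Z m d := by
  rintro _ ⟨-, y, hy0, hy, rfl⟩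
  have htr : 0 < (momentTrace m d y)⁻¹ := inv_pos.mpr (momentTrace_pos hy hy0)
  have hsub : normalizedZeta m d ⊆ {v | ∀ hv : v ≠ 0, rayOfNeZero ℝ v hv ∈ Z m d} := by
    rintro _ ⟨x, hx, rfl⟩ hv
    have hx0 : x ≠ 0 := by
      rintro rfl
      simp at hx
    rw [rayOfNeZero_smul (zeta_ne_zero m _ hx0) (inv_pos.mpr
      (momentTrace_pos (posSemidef_momentMatrix_zeta x) (zeta_ne_zero m _ hx0)))]
    exact rayOfNeZero_zeta_mem_Z hx0
  have := convexHull_min hsub (convex_setOf_rayOfNeZero_mem isConvex_Z)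
    (smul_mem_convexHull_of_posSemidef hP hy hy0) (smul_ne_zero htr.ne' hy0)
  rwa [rayOfNeZero_smul hy0 htr] at this

end MomentHull

end

theorem theorem1 (m d : ℕ) (h : m = 1 ∨ d = 1 ∨ (d = 2 ∧ m = 2)) :
    MomentHull.Z m d = MomentHull.Y m d := by
  refine Set.Subset.antisymm MomentHull.Z_subset_Y (MomentHull.Y_subset_Z fun f hf hnn hne => ?_)
  rcases h with rfl | rfl | ⟨rfl, rfl⟩
  · exact MomentHull.dominatesSquare_binary hf hnn hne
  · exact MomentHull.dominatesSquare_quadratic hf hnn hne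
  · exact MomentHull.dominatesSquare_ternary_quartic hf hnn hne
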